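/- Let $\mu\in\mathbb R$ and $\sigma>0$ be known, and let the unknown parameter $\alpha$ lie in $\Theta=\{\alpha\in\mathbb R:|\alpha|>0\}$. Let $X_1,X_2,\dots$ be i.i.d. real random variables with the density $$f(x;\mu,\sigma,\alpha)=\frac{1}{\sqrt{2\pi\sigma^2}}\exp\Big[-\frac12\Big(\frac{x-\mu}{\sigma}\Big)^2-\frac{\alpha^2}{2}\Big]\cosh\Big[\alpha\,\frac{x-\mu}{\sigma}\Big],\qquad x\in\mathbb R,$$ and let $l_n(a)=\sum_{i=1}^n\log f(X_i;\mu,\sigma,a)$ be the log-likelihood of the first $n$ observations. A consistent solution of the log-likelihood equation (at the true value $\alpha$) is a sequence of real random variables $\widehat\alpha_n$ such that $\mathbb P\big(\widehat\alpha_n\in\Theta,\ l_n'(\widehat\alpha_n)=0\big)\to1$ and $\widehat\alpha_n\to\alpha$ in probability as $n\to\infty$. Theorem (CLT for the MLE). The Fisher information $\mathcal I(\alpha)=\mathbb E\big[\big(\partial_\alpha\log f(X_1;\mu,\sigma,\alpha)\big)^2\big]$ is finite and positive, and $$\mathcal I(\alpha)=1-e^{-\alpha^2/2}\,\mathbb E\big[Z^2\,\mathrm{sech}(\alpha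 Z)\big],\qquad Z\sim N(0,1),$$ where the expectation on the right is finite. A consistent solution of the log-likelihood equation exists, with each $\widehat\alpha_n$ a measurable function of $(X_1,\dots,X_n)$ (which may depend on the known $\mu,\sigma$ and on the true value $\alpha$, for example through its sign). For every consistent solution $(\widehat\alpha_n)$, $\sqrt n\,(\widehat\alpha_n-\alpha)$ converges in distribution to $N\big(0,1/\mathcal I(\alpha)\big)$ as $n\to\infty$. -/

import Mathlib

open MeasureTheory ProbabilityTheory Filter Topology

noncomputable section

namespace BimodalNormal

/-- The density of the uni- or bimodal normal distribution `BN(μ, σ, α)`. -/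
def density (μ σ α x : ℝ) : ℝ :=
  1 / Real.sqrt (2 * Real.pi * σ ^ 2) *
    Real.exp (-(1 / 2) * ((x - μ) / σ) ^ 2 - α ^ 2 / 2) * Real.cosh (α * ((x - μ) / σ))

/-- The distribution `BN(μ, σ, α)`: the measure on `ℝ` with Lebesgue density `density μ σ α`. -/
def law (μ σ α : ℝ) : Measure ℝ :=
  volume.withDensity (fun x => ENNReal.ofReal (density μ σ α x))

/-- The parameter space `Θ = {α : |α| > 0}`. -/
def paramSpace : Set ℝ := {α | 0 < |α|}

/-- The log-likelihood of the parameter `a` for a sample `x` of size `n`, with `μ`, `σ` known. -/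
def logLikelihood (μ σ : ℝ) {n : ℕ} (x : Fin n → ℝ) (a : ℝ) : ℝ :=
  ∑ i, Real.log (density μ σ a (x i))

/-- The score of one observation: `∂ log f(x; μ, σ, α) / ∂α`. -/
def score (μ σ α x : ℝ) : ℝ :=
  deriv (fun a => Real.log (density μ σ a x)) α

/-- The Fisher information `E[(∂ log f(X; μ, σ, α) / ∂α)²]` with `X ∼ BN(μ, σ, α)`. -/
def fisherInfo (μ σ α : ℝ) : ℝ :=
  ∫ x, (score μ σ α x) ^ 2 ∂(law μ σ α)

/-- The first `n` observations. -/
def sample {Ω : Type*} (X : ℕ → Ω → ℝ) (n : ℕ) (ω : Ω) : Fin n → ℝ :=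
  fun i => X i ω

/-- `αhat` is a consistent solution of the log-likelihood equation `∂l/∂α = 0` for the
observations `X` and the true parameter `α`: with probability tending to `1` the random variable
`αhat n` lies in the parameter space and solves the equation for the first `n` observations,
and `αhat n` converges to `α` in probability. -/
structure IsConsistentSolution {Ω : Type*} [MeasurableSpace Ω] (P : Measure Ω) (μ σ α : ℝ)
    (X : ℕ → Ω → ℝ) (αhat : ℕ → Ω → ℝ) : Prop where
  aemeasurable : ∀ n, AEMeasurable (αhat n) P
  solves : Tendsto (fun n => P {ω | αhat n ω ∈ paramSpace ∧
    deriv (logLikelihood μ σ (sample X n ω)) (αhat n ω) = 0}) atTop (𝓝 1)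
  consistent : TendstoInMeasure P αhat atTop (fun _ => α)

end BimodalNormal

end

/-! With `y = (x - μ) / σ` the score is `y * tanh (α * y) - α`, and `y` has the standard normal law
tilted by `exp (-α ^ 2 / 2) * cosh (α * y)`. The tilt cancels the denominators of `tanh`, so score
moments reduce to exponential Gaussian moments and one sech integral. The same computation gives
mean zero and the information equality: the mean of minus the derivative of the score is the Fisher
information `J`.

The rest is general theory of an estimating equation, packaged in `IsEstimatingFunction`: the
averaged score at `a` is `G - B * (a - θ)` up to `M * (a - θ) ^ 2`. By the law of large numbers `G →
0`, `B → J` and `M` stays bounded. Hence the averaged score changes sign near `θ`, which yields a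
root (`exists_consistent_root`). At any consistent root the quotient `G / (T - θ)` tends to `J`, so
the central limit theorem for `√n * G` and Slutsky's lemma give the limit law
(`tendstoInDistribution_root`). -/

namespace Real

/-! ### Lipschitz and Taylor bounds for the hyperbolic tangent -/

theorem hasDerivAt_tanh (x : ℝ) : HasDerivAt tanh (1 - tanh x ^ 2) x := by
  have h := (hasDerivAt_sinh x).div (hasDerivAt_cosh x) (cosh_pos x).ne'
  have e : (sinh / cosh : ℝ → ℝ) = tanh := funext fun y => (tanh_eq_sinh_div_cosh y).symm
  rw [e] at h
  refine h.congr_deriv ?_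
  rw [tanh_eq_sinh_div_cosh]
  have := (cosh_pos x).ne'
  field_simp

theorem continuous_tanh : Continuous tanh :=
  continuous_iff_continuousAt.2 fun x => (hasDerivAt_tanh x).continuousAt

theorem abs_tanh_sub_tanh_le (x y : ℝ) : |tanh x - tanh y| ≤ |x - y| := by
  have h := Convex.norm_image_sub_le_of_norm_hasDerivWithin_le (f := tanh)
    (f' := fun x => 1 - tanh x ^ 2) (s := Set.univ) (C := 1) (x := y) (y := x)
    (fun z _ => (hasDerivAt_tanh z).hasDerivWithinAt)
    (fun z _ => by
      rw [norm_eq_abs, abs_le]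
      constructor <;> nlinarith [tanh_sq_lt_one z, sq_nonneg (tanh z)])
    convex_univ trivial trivial
  simpa using h

theorem abs_tanh_sq_sub_tanh_sq_le (x y : ℝ) : |tanh x ^ 2 - tanh y ^ 2| ≤ 2 * |x - y| := by
  rw [sq_sub_sq, abs_mul]
  have h : |tanh x + tanh y| ≤ 2 := by
    linarith [abs_add_le (tanh x) (tanh y), abs_tanh_lt_one x, abs_tanh_lt_one y]
  exact mul_le_mul h (abs_tanh_sub_tanh_le x y) (abs_nonneg _) (by norm_num)

/-- Second order Taylor bound for the hyperbolic tangent. -/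
theorem abs_tanh_sub_tanh_sub_le (x y : ℝ) :
    |tanh x - tanh y - (1 - tanh y ^ 2) * (x - y)| ≤ 2 * (x - y) ^ 2 := by
  -- Mean value inequality for `tanh` minus its tangent slope at `y`; the derivative `tanh y ^ 2 -
  -- tanh z ^ 2` is at most `2 * |x - y|` on the segment.
  have h := Convex.norm_image_sub_le_of_norm_hasDerivWithin_le
    (f := fun z => tanh z - (1 - tanh y ^ 2) * z)
    (f' := fun z => (1 - tanh z ^ 2) - (1 - tanh y ^ 2) * 1) (s := Set.uIcc y x)
    (C := 2 * |x - y|) (x := y) (y := x)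
    (fun z _ => ((hasDerivAt_tanh z).sub ((hasDerivAt_id z).const_mul _)).hasDerivWithinAt)
    (fun z hz => by
      have h1 := abs_tanh_sq_sub_tanh_sq_le y z
      have h2 : |y - z| ≤ |x - y| := by
        rw [abs_sub_comm]
        exact Set.abs_sub_left_of_mem_uIcc hz
      calc ‖1 - tanh z ^ 2 - (1 - tanh y ^ 2) * 1‖ = |tanh y ^ 2 - tanh z ^ 2| := by
            rw [norm_eq_abs]; congr 1; ring
        _ ≤ 2 * |x - y| := by linarith)
    (convex_uIcc y x) Set.left_mem_uIcc Set.right_mem_uIcc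
  calc _ = ‖tanh x - (1 - tanh y ^ 2) * x - (tanh y - (1 - tanh y ^ 2) * y)‖ := by
        rw [norm_eq_abs]; congr 1; ring
    _ ≤ 2 * |x - y| * |x - y| := h
    _ = 2 * (x - y) ^ 2 := by rw [mul_assoc, ← sq, sq_abs]

end Real

/-! ### The score, its expansion, and the law as a tilted Gaussian -/

namespace BimodalNormal

variable {μ σ : ℝ}

theorem hasDerivAt_log_density (hσ : 0 < σ) (a x : ℝ) :
    HasDerivAt (fun a => Real.log (density μ σ a x))
      ((x - μ) / σ * Real.tanh (a * ((x - μ) / σ)) - a) a := by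
  set y := (x - μ) / σ with hy
  have e : (fun a => Real.log (density μ σ a x)) = fun a =>
      Real.log (1 / Real.sqrt (2 * Real.pi * σ ^ 2)) + (-(1 / 2) * y ^ 2 - a ^ 2 / 2)
        + Real.log (Real.cosh (a * y)) := by
    ext a
    have h1 : 1 / Real.sqrt (2 * Real.pi * σ ^ 2) ≠ 0 := by
      have := Real.pi_pos
      positivity
    rw [density, Real.log_mul (mul_ne_zero h1 (Real.exp_ne_zero _)) (Real.cosh_pos _).ne',
      Real.log_mul h1 (Real.exp_ne_zero _), Real.log_exp]
  rw [e]
  have h1 : HasDerivAt (fun a : ℝ => a * y) y a := by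
    simpa using (hasDerivAt_id a).mul_const y
  have h2 := (h1.cosh).log (Real.cosh_pos (a * y)).ne'
  have h3 : HasDerivAt (fun a : ℝ => Real.log (1 / Real.sqrt (2 * Real.pi * σ ^ 2))
      + (-(1 / 2) * y ^ 2 - a ^ 2 / 2)) (-a) a := by
    have := ((((hasDerivAt_id a).pow 2).div_const 2).const_sub
      (-(1 / 2) * y ^ 2)).const_add (Real.log (1 / Real.sqrt (2 * Real.pi * σ ^ 2)))
    refine this.congr_deriv ?_
    simp
  refine (h3.add h2).congr_deriv ?_
  rw [Real.tanh_eq_sinh_div_cosh]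
  ring

theorem score_eq (hσ : 0 < σ) (a x : ℝ) :
    score μ σ a x = (x - μ) / σ * Real.tanh (a * ((x - μ) / σ)) - a :=
  (hasDerivAt_log_density hσ a x).deriv

theorem deriv_logLikelihood (hσ : 0 < σ) {n : ℕ} (x : Fin n → ℝ) (a : ℝ) :
    deriv (logLikelihood μ σ x) a = ∑ i, score μ σ a (x i) := by
  have h : HasDerivAt (logLikelihood μ σ x)
      (∑ i, ((x i - μ) / σ * Real.tanh (a * ((x i - μ) / σ)) - a)) a :=
    HasDerivAt.fun_sum fun i _ => hasDerivAt_log_density hσ a (x i)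
  rw [h.deriv]
  exact Finset.sum_congr rfl fun i _ => (score_eq hσ a (x i)).symm

theorem measurable_score (hσ : 0 < σ) : Measurable fun p : ℝ × ℝ => score μ σ p.2 p.1 := by
  have := Real.continuous_tanh
  simp only [score_eq hσ]
  exact Continuous.measurable (by fun_prop)

theorem continuous_score (hσ : 0 < σ) (x : ℝ) : Continuous fun a => score μ σ a x := by
  have := Real.continuous_tanh
  simp only [score_eq hσ]
  fun_prop

/-- Minus the derivative of the score of one observation. -/
noncomputable def obsInfo (μ σ α x : ℝ) : ℝ :=
  1 - ((x - μ) / σ) ^ 2 * (1 - Real.tanh (α * ((x - μ) / σ)) ^ 2)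

theorem measurable_obsInfo (α : ℝ) : Measurable (obsInfo μ σ α) := by
  have := Real.continuous_tanh
  unfold obsInfo
  exact Continuous.measurable (by fun_prop)

/-- The cube comes from one factor `y` in the score and two from the squared increment of `a * y`.
-/
theorem abs_score_sub_score_add_le (hσ : 0 < σ) (α a x : ℝ) :
    |score μ σ a x - score μ σ α x + obsInfo μ σ α x * (a - α)| ≤
      2 * |(x - μ) / σ| ^ 3 * (a - α) ^ 2 := by
  rw [score_eq hσ, score_eq hσ, obsInfo]
  set y := (x - μ) / σ
  have h := Real.abs_tanh_sub_tanh_sub_le (a * y) (α * y)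
  calc _ = |y * (Real.tanh (a * y) - Real.tanh (α * y)
          - (1 - Real.tanh (α * y) ^ 2) * (a * y - α * y))| := by congr 1; ring
    _ = |y| * |(Real.tanh (a * y) - Real.tanh (α * y)
          - (1 - Real.tanh (α * y) ^ 2) * (a * y - α * y))| := abs_mul _ _
    _ ≤ |y| * (2 * (a * y - α * y) ^ 2) := by gcongr
    _ = _ := by
      rw [← sub_mul, mul_pow, ← sq_abs y]
      ring

/-- The law as an affine image of a reweighted standard normal distribution. -/
theorem law_eq_map (hσ : 0 < σ) (α : ℝ) :
    law μ σ α = (((gaussianReal 0 1).withDensity fun z =>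
      ENNReal.ofReal (Real.exp (-(α ^ 2) / 2) * Real.cosh (α * z))).map fun z => σ * z + μ) := by
  have hmap : (gaussianReal 0 1).map (fun z => σ * z + μ)
      = gaussianReal μ (NNReal.mk (σ ^ 2) (sq_nonneg σ)) := by
    have h1 := gaussianReal_map_const_mul (μ := 0) (v := 1) σ
    have h2 := gaussianReal_map_add_const (μ := σ * 0) (v := NNReal.mk (σ ^ 2) (sq_nonneg σ) * 1) μ
    have h3 : (fun z => σ * z + μ) = (fun z => z + μ) ∘ (fun z => σ * z) := rfl
    rw [h3, ← Measure.map_map (by fun_prop) (by fun_prop), h1, h2]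
    simp
  have hv : NNReal.mk (σ ^ 2) (sq_nonneg σ) ≠ 0 := by
    intro h
    exact (pow_pos hσ 2).ne' (congrArg NNReal.toReal h)
  have key : law μ σ α = ((gaussianReal 0 1).map (fun z => σ * z + μ)).withDensity (fun x =>
      ENNReal.ofReal (Real.exp (-(α ^ 2) / 2) * Real.cosh (α * ((x - μ) / σ)))) := by
    rw [hmap, gaussianReal_of_var_ne_zero _ hv, law, ← withDensity_mul _ (by fun_prop) (by fun_prop)]
    congr 1
    ext x
    rw [Pi.mul_apply]
    change _ = ENNReal.ofReal (gaussianPDFReal _ _ _) * _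
    rw [← ENNReal.ofReal_mul (gaussianPDFReal_nonneg _ _ _)]
    congr 1
    rw [gaussianPDFReal, density, ← mul_assoc, mul_assoc _ (Real.exp _) (Real.exp _), ← Real.exp_add]
    simp only [NNReal.coe_mk]
    rw [one_div]
    congr 3
    field_simp
    ring
  rw [key]
  ext s hs
  have hm : Measurable fun z => σ * z + μ := by fun_prop
  rw [withDensity_apply _ hs, Measure.map_apply hm hs, withDensity_apply _ (hm hs),
    setLIntegral_map hs (by fun_prop) hm]
  congr 1
  ext z
  congr 4
  field_simp
  ring

theorem integral_law (hσ : 0 < σ) (α : ℝ) {f : ℝ → ℝ} (hf : Measurable f) :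
    ∫ x, f ((x - μ) / σ) ∂law μ σ α =
      ∫ z, Real.exp (-(α ^ 2) / 2) * Real.cosh (α * z) * f z ∂gaussianReal 0 1 := by
  have hf' : Measurable fun x => f ((x - μ) / σ) := hf.comp (by fun_prop)
  rw [law_eq_map hσ, integral_map (by fun_prop) hf'.aestronglyMeasurable,
    integral_withDensity_eq_integral_toReal_smul (by fun_prop) (by simp)]
  congr 1
  ext z
  rw [ENNReal.toReal_ofReal (by have := Real.cosh_pos (α * z); positivity), smul_eq_mul]
  congr 2
  field_simp
  ring

theorem integrable_law (hσ : 0 < σ) (α : ℝ) {f : ℝ → ℝ} (hf : Measurable f)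
    (h : Integrable (fun z => Real.exp (-(α ^ 2) / 2) * Real.cosh (α * z) * f z)
      (gaussianReal 0 1)) : Integrable (fun x => f ((x - μ) / σ)) (law μ σ α) := by
  have hf' : Measurable fun x => f ((x - μ) / σ) := hf.comp (by fun_prop)
  rw [law_eq_map hσ, integrable_map_measure hf'.aestronglyMeasurable
    (by fun_prop), integrable_withDensity_iff_integrable_smul' (by fun_prop) (by simp)]
  convert h using 2 with z
  rw [ENNReal.toReal_ofReal (by have := Real.cosh_pos (α * z); positivity), smul_eq_mul,
    Function.comp_apply]
  congr 2
  field_simp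
  ring

end BimodalNormal

/-! ### Gaussian moments and the Fisher information -/

namespace BimodalNormal

variable {μ σ : ℝ}

theorem integrable_abs_pow_mul_exp_gaussianReal (n : ℕ) (t : ℝ) :
    Integrable (fun z : ℝ => |z| ^ n * Real.exp (t * z)) (gaussianReal 0 1) :=
  integrable_pow_abs_mul_exp_of_mem_interior_integrableExpSet (X := fun z : ℝ => z) (by simp) n

theorem integrable_pow_mul_exp_gaussianReal (n : ℕ) (t : ℝ) :
    Integrable (fun z : ℝ => z ^ n * Real.exp (t * z)) (gaussianReal 0 1) :=
  integrable_pow_mul_exp_of_mem_interior_integrableExpSet (X := fun z : ℝ => z) (by simp) n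

theorem integral_exp_gaussianReal (t : ℝ) :
    ∫ z, Real.exp (t * z) ∂gaussianReal 0 1 = Real.exp (t ^ 2 / 2) := by
  have := congrFun (mgf_fun_id_gaussianReal (μ := 0) (v := 1)) t
  simpa [mgf] using this

/-- Differentiating the moment generating function in `t` brings down a factor `z`; one more
derivative gives the second moment below. -/
theorem integral_mul_exp_gaussianReal (t : ℝ) :
    ∫ z, z * Real.exp (t * z) ∂gaussianReal 0 1 = t * Real.exp (t ^ 2 / 2) := by
  have h := hasDerivAt_integral_pow_mul_exp_real (X := fun z : ℝ => z) (μ := gaussianReal 0 1)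
    (t := t) (by simp) 0
  simp only [pow_zero, one_mul, zero_add, pow_one, integral_exp_gaussianReal] at h
  refine h.unique ((((hasDerivAt_id t).pow 2).div_const 2).exp.congr_deriv ?_)
  simp
  ring

theorem integral_sq_mul_exp_gaussianReal (t : ℝ) :
    ∫ z, z ^ 2 * Real.exp (t * z) ∂gaussianReal 0 1 = (1 + t ^ 2) * Real.exp (t ^ 2 / 2) := by
  have h := hasDerivAt_integral_pow_mul_exp_real (X := fun z : ℝ => z) (μ := gaussianReal 0 1)
    (t := t) (by simp) 1
  simp only [pow_one, integral_mul_exp_gaussianReal] at h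
  refine h.unique (((hasDerivAt_id t).mul
    (((hasDerivAt_id t).pow 2).div_const 2).exp).congr_deriv ?_)
  simp
  ring

theorem integrable_abs_pow_mul_cosh (n : ℕ) (α : ℝ) :
    Integrable (fun z : ℝ => |z| ^ n * Real.cosh (α * z)) (gaussianReal 0 1) := by
  convert! ((integrable_abs_pow_mul_exp_gaussianReal n α).add
    (integrable_abs_pow_mul_exp_gaussianReal n (-α))).div_const 2 using 2 with z
  simp only [Pi.add_apply, Real.cosh_eq, neg_mul]
  ring

theorem integrable_cosh (α : ℝ) :
    Integrable (fun z : ℝ => Real.cosh (α * z)) (gaussianReal 0 1) := by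
  simpa using integrable_abs_pow_mul_cosh 0 α

theorem integrable_sq_mul_cosh (α : ℝ) :
    Integrable (fun z : ℝ => z ^ 2 * Real.cosh (α * z)) (gaussianReal 0 1) := by
  simpa using integrable_abs_pow_mul_cosh 2 α

theorem integrable_mul_sinh (α : ℝ) :
    Integrable (fun z : ℝ => z * Real.sinh (α * z)) (gaussianReal 0 1) := by
  convert! ((integrable_pow_mul_exp_gaussianReal 1 α).sub
    (integrable_pow_mul_exp_gaussianReal 1 (-α))).div_const 2 using 2 with z
  simp only [Pi.sub_apply, Real.sinh_eq, neg_mul]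
  ring

theorem integral_cosh (α : ℝ) :
    ∫ z, Real.cosh (α * z) ∂gaussianReal 0 1 = Real.exp (α ^ 2 / 2) := by
  have h : ∀ z, Real.cosh (α * z) = (Real.exp (α * z) + Real.exp (-α * z)) / 2 := fun z => by
    rw [Real.cosh_eq, neg_mul]
  simp_rw [h]
  rw [integral_div, integral_add (integrable_exp_mul_gaussianReal _)
    (integrable_exp_mul_gaussianReal _), integral_exp_gaussianReal, integral_exp_gaussianReal,
    neg_sq]
  ring

theorem integral_mul_sinh (α : ℝ) :
    ∫ z, z * Real.sinh (α * z) ∂gaussianReal 0 1 = α * Real.exp (α ^ 2 / 2) := by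
  have h : ∀ z, z * Real.sinh (α * z) =
      (z * Real.exp (α * z) - z * Real.exp (-α * z)) / 2 := fun z => by
    rw [Real.sinh_eq, neg_mul]
    ring
  have hi := fun t => integrable_pow_mul_exp_gaussianReal 1 t
  simp only [pow_one] at hi
  simp_rw [h]
  rw [integral_div, integral_sub (hi _) (hi _), integral_mul_exp_gaussianReal,
    integral_mul_exp_gaussianReal, neg_sq]
  ring

theorem integral_sq_mul_cosh (α : ℝ) :
    ∫ z, z ^ 2 * Real.cosh (α * z) ∂gaussianReal 0 1 = (1 + α ^ 2) * Real.exp (α ^ 2 / 2) := by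
  have h : ∀ z, z ^ 2 * Real.cosh (α * z) =
      (z ^ 2 * Real.exp (α * z) + z ^ 2 * Real.exp (-α * z)) / 2 := fun z => by
    rw [Real.cosh_eq, neg_mul]
    ring
  have hi := fun t => integrable_pow_mul_exp_gaussianReal 2 t
  simp_rw [h]
  rw [integral_div, integral_add (hi _) (hi _), integral_sq_mul_exp_gaussianReal,
    integral_sq_mul_exp_gaussianReal, neg_sq]
  ring

theorem integrable_sq_mul_sech (α : ℝ) :
    Integrable (fun z : ℝ => z ^ 2 * (1 / Real.cosh (α * z))) (gaussianReal 0 1) := by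
  refine (integrable_sq_mul_cosh α).mono' (by fun_prop) (ae_of_all _ fun z => ?_)
  have h := Real.one_le_cosh (α * z)
  have h0 := Real.cosh_pos (α * z)
  rw [Real.norm_of_nonneg (by positivity)]
  have : 1 / Real.cosh (α * z) ≤ 1 := by rw [div_le_one h0]; exact h
  gcongr
  linarith

/-- Since `cosh * tanh ^ 2 = cosh - sech`, the sech term is the only one without a closed-form
Gaussian integral. -/
theorem weight_mul_score_sq (α z : ℝ) :
    Real.exp (-(α ^ 2) / 2) * Real.cosh (α * z) * (z * Real.tanh (α * z) - α) ^ 2 =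
      Real.exp (-(α ^ 2) / 2) * (z ^ 2 * Real.cosh (α * z) - z ^ 2 * (1 / Real.cosh (α * z))
        - 2 * α * (z * Real.sinh (α * z)) + α ^ 2 * Real.cosh (α * z)) := by
  rw [Real.tanh_eq_sinh_div_cosh]
  have h := Real.cosh_sq (α * z)
  have := (Real.cosh_pos (α * z)).ne'
  field_simp
  linear_combination (-z ^ 2) * h

theorem weight_mul_obsInfo (α z : ℝ) :
    Real.exp (-(α ^ 2) / 2) * Real.cosh (α * z) * (1 - z ^ 2 * (1 - Real.tanh (α * z) ^ 2)) =
      Real.exp (-(α ^ 2) / 2) * (Real.cosh (α * z) - z ^ 2 * (1 / Real.cosh (α * z))) := by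
  rw [Real.tanh_eq_sinh_div_cosh]
  have h := Real.cosh_sq (α * z)
  have := (Real.cosh_pos (α * z)).ne'
  field_simp
  linear_combination (-z ^ 2) * h

theorem weight_mul_score (α z : ℝ) :
    Real.exp (-(α ^ 2) / 2) * Real.cosh (α * z) * (z * Real.tanh (α * z) - α) =
      Real.exp (-(α ^ 2) / 2) * (z * Real.sinh (α * z) - α * Real.cosh (α * z)) := by
  rw [Real.tanh_eq_sinh_div_cosh]
  have := (Real.cosh_pos (α * z)).ne'
  field_simp

theorem integrable_score_sq_aux (α : ℝ) : Integrable (fun z => z ^ 2 * Real.cosh (α * z)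
    - z ^ 2 * (1 / Real.cosh (α * z)) - 2 * α * (z * Real.sinh (α * z))
      + α ^ 2 * Real.cosh (α * z)) (gaussianReal 0 1) :=
  (((integrable_sq_mul_cosh α).sub (integrable_sq_mul_sech α)).sub
    ((integrable_mul_sinh α).const_mul _)).add ((integrable_cosh α).const_mul _)

theorem exp_neg_mul_exp (α : ℝ) : Real.exp (-(α ^ 2) / 2) * Real.exp (α ^ 2 / 2) = 1 := by
  rw [← Real.exp_add, neg_div, neg_add_cancel, Real.exp_zero]

theorem measurable_mul_tanh_sub (α : ℝ) : Measurable fun z : ℝ => z * Real.tanh (α * z) - α := by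
  have := Real.continuous_tanh
  exact Continuous.measurable (by fun_prop)

theorem integrable_score_sq (hσ : 0 < σ) (α : ℝ) :
    Integrable (fun x => score μ σ α x ^ 2) (law μ σ α) := by
  simp only [score_eq hσ]
  refine integrable_law (f := fun y => (y * Real.tanh (α * y) - α) ^ 2) hσ α
    ((measurable_mul_tanh_sub α).pow_const 2) ?_
  simp only [weight_mul_score_sq]
  exact (integrable_score_sq_aux α).const_mul _

theorem integrable_score (hσ : 0 < σ) (α : ℝ) :
    Integrable (fun x => score μ σ α x) (law μ σ α) := by
  simp only [score_eq hσ]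
  refine integrable_law (f := fun y => y * Real.tanh (α * y) - α) hσ α
    (measurable_mul_tanh_sub α) ?_
  simp only [weight_mul_score]
  exact ((integrable_mul_sinh α).sub ((integrable_cosh α).const_mul _)).const_mul _

theorem integral_score (hσ : 0 < σ) (α : ℝ) : ∫ x, score μ σ α x ∂law μ σ α = 0 := by
  simp only [score_eq hσ]
  rw [integral_law hσ α (measurable_mul_tanh_sub α)]
  simp only [weight_mul_score]
  rw [integral_const_mul, integral_sub (integrable_mul_sinh α) ((integrable_cosh α).const_mul _),
    integral_const_mul, integral_mul_sinh, integral_cosh, sub_self, mul_zero]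

/-- The elementary terms contribute `(1 + α ^ 2) - 2 * α ^ 2 + α ^ 2 = 1`. -/
theorem fisherInfo_eq (hσ : 0 < σ) (α : ℝ) :
    fisherInfo μ σ α = 1 - Real.exp (-(α ^ 2) / 2) *
      ∫ z, z ^ 2 * (1 / Real.cosh (α * z)) ∂(gaussianReal 0 1) := by
  unfold fisherInfo
  simp only [score_eq hσ]
  rw [integral_law hσ α ((measurable_mul_tanh_sub α).pow_const 2)]
  simp only [weight_mul_score_sq]
  have h1 := integrable_sq_mul_cosh α
  have h2 := integrable_sq_mul_sech α
  have h3 := (integrable_mul_sinh α).const_mul (2 * α)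
  have h4 := (integrable_cosh α).const_mul (α ^ 2)
  have h12 : Integrable (fun z => z ^ 2 * Real.cosh (α * z) - z ^ 2 * (1 / Real.cosh (α * z)))
    (gaussianReal 0 1) := h1.sub h2
  have h123 : Integrable (fun z => z ^ 2 * Real.cosh (α * z) - z ^ 2 * (1 / Real.cosh (α * z))
    - 2 * α * (z * Real.sinh (α * z))) (gaussianReal 0 1) := h12.sub h3
  rw [integral_const_mul, integral_add h123 h4, integral_sub h12 h3,
    integral_sub h1 h2, integral_const_mul, integral_const_mul, integral_mul_sinh, integral_cosh,
    integral_sq_mul_cosh]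
  linear_combination exp_neg_mul_exp α

theorem measurable_obsInfo_std (α : ℝ) :
    Measurable fun z : ℝ => 1 - z ^ 2 * (1 - Real.tanh (α * z) ^ 2) := by
  have := Real.continuous_tanh
  exact Continuous.measurable (by fun_prop)

theorem integrable_obsInfo (hσ : 0 < σ) (α : ℝ) :
    Integrable (obsInfo μ σ α) (law μ σ α) := by
  refine integrable_law (f := fun y => 1 - y ^ 2 * (1 - Real.tanh (α * y) ^ 2)) hσ α
    (measurable_obsInfo_std α) ?_
  simp only [weight_mul_obsInfo]
  exact ((integrable_cosh α).sub (integrable_sq_mul_sech α)).const_mul _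

/-- The information equality. -/
theorem integral_obsInfo (hσ : 0 < σ) (α : ℝ) :
    ∫ x, obsInfo μ σ α x ∂law μ σ α = fisherInfo μ σ α := by
  rw [fisherInfo_eq hσ]
  unfold obsInfo
  rw [integral_law hσ α (measurable_obsInfo_std α)]
  simp only [weight_mul_obsInfo]
  rw [integral_const_mul, integral_sub (integrable_cosh α) (integrable_sq_mul_sech α),
    integral_cosh, mul_sub, exp_neg_mul_exp]

theorem integrable_remainder (hσ : 0 < σ) (α : ℝ) :
    Integrable (fun x => 2 * |(x - μ) / σ| ^ 3) (law μ σ α) := by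
  refine integrable_law (f := fun y => 2 * |y| ^ 3) hσ α (by fun_prop) ?_
  convert! (integrable_abs_pow_mul_cosh 3 α).const_mul (Real.exp (-(α ^ 2) / 2) * 2) using 2 with z
  ring

/-- The integrand is continuous and nonnegative, it is nonzero at `z = 0` because the score there is
`-α`, and the Gaussian charges every nonempty open set. -/
theorem fisherInfo_pos (hσ : 0 < σ) {α : ℝ} (hα : α ≠ 0) : 0 < fisherInfo μ σ α := by
  unfold fisherInfo
  simp only [score_eq hσ]
  rw [integral_law hσ α ((measurable_mul_tanh_sub α).pow_const 2)]
  have hc := Real.continuous_tanh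
  have : (gaussianReal 0 1).IsOpenPosMeasure :=
    (gaussianReal_absolutelyContinuous' 0 (v := 1) one_ne_zero).isOpenPosMeasure
  refine integral_pos_of_integrable_nonneg_nonzero (x := 0) (by fun_prop) ?_
    (fun z => by have := Real.cosh_pos (α * z); positivity) ?_
  · simp only [weight_mul_score_sq]
    exact (integrable_score_sq_aux α).const_mul _
  · simpa using hα

end BimodalNormal

/-! ### Events of vanishing probability -/

section ConvergenceInProbability

variable {Ω : Type*} [MeasurableSpace Ω] {P : Measure Ω}

theorem tendsto_measure_zero_of_subset {s t : ℕ → Set Ω} (hst : ∀ n, s n ⊆ t n)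
    (ht : Tendsto (fun n => P (t n)) atTop (𝓝 0)) : Tendsto (fun n => P (s n)) atTop (𝓝 0) :=
  tendsto_of_tendsto_of_tendsto_of_le_of_le tendsto_const_nhds ht (fun _ => zero_le)
    fun n => measure_mono (hst n)

theorem tendsto_measure_zero_union {s t : ℕ → Set Ω}
    (hs : Tendsto (fun n => P (s n)) atTop (𝓝 0)) (ht : Tendsto (fun n => P (t n)) atTop (𝓝 0)) :
    Tendsto (fun n => P (s n ∪ t n)) atTop (𝓝 0) :=
  tendsto_of_tendsto_of_tendsto_of_le_of_le tendsto_const_nhds (by simpa using hs.add ht)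
    (fun _ => zero_le) fun n => measure_union_le _ _

/-- Subadditivity suffices in this direction, so no measurability is required; the converse below
does need it. -/
theorem tendsto_measure_one_of_compl [IsProbabilityMeasure P] {s : ℕ → Set Ω}
    (hs : Tendsto (fun n => P (s n)ᶜ) atTop (𝓝 0)) : Tendsto (fun n => P (s n)) atTop (𝓝 1) := by
  have h : Tendsto (fun n => 1 - P (s n)ᶜ) atTop (𝓝 1) := by
    simpa using ENNReal.Tendsto.sub (tendsto_const_nhds (x := (1 : ENNReal))) hs (by simp)
  refine tendsto_of_tendsto_of_tendsto_of_le_of_le h tendsto_const_nhds (fun n => ?_)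
    fun n => prob_le_one
  rw [tsub_le_iff_right, ← measure_univ (μ := P)]
  exact measure_univ_le_add_compl _

theorem tendsto_measure_compl_zero [IsProbabilityMeasure P] {s : ℕ → Set Ω}
    (hm : ∀ n, NullMeasurableSet (s n) P) (hs : Tendsto (fun n => P (s n)) atTop (𝓝 1)) :
    Tendsto (fun n => P (s n)ᶜ) atTop (𝓝 0) := by
  simp_rw [fun n => prob_compl_eq_one_sub₀ (hm n)]
  simpa using ENNReal.Tendsto.sub (tendsto_const_nhds (x := (1 : ENNReal))) hs (by simp)

end ConvergenceInProbability

/-! ### Measurable selection of a zero -/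

/-- The supremum of the rational points of `[a, b]` at which `f` is positive. -/
noncomputable def supRatPos (a b : ℝ) (f : ℝ → ℝ) : ℝ :=
  open Classical in ⨆ q : ℚ, if ((q : ℝ) ∈ Set.Icc a b ∧ 0 < f q) then (q : ℝ) else a

/-- If `f` were negative at the supremum, it would be negative just to the left, where rational
points with `f > 0` must accumulate; if positive, a larger rational point would qualify. -/
theorem supRatPos_spec {a b : ℝ} (hab : a < b) {f : ℝ → ℝ} (hf : Continuous f) (ha : 0 < f a)
    (hb : f b < 0) : supRatPos a b f ∈ Set.Icc a b ∧ f (supRatPos a b f) = 0 := by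
  classical
  set u : ℚ → ℝ := fun q => if ((q : ℝ) ∈ Set.Icc a b ∧ 0 < f q) then (q : ℝ) else a with hu
  have hTdef : supRatPos a b f = ⨆ q, u q := by
    simp only [supRatPos, hu]
  rw [hTdef]
  set T := ⨆ q, u q with hT
  have hub : ∀ q, u q ≤ b := fun q => by
    simp only [hu]; split_ifs with h
    exacts [h.1.2, hab.le]
  have hlb : ∀ q, a ≤ u q := fun q => by
    simp only [hu]; split_ifs with h
    exacts [h.1.1, le_rfl]
  have hbdd : BddAbove (Set.range u) := ⟨b, by rintro _ ⟨q, rfl⟩; exact hub q⟩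
  have hTb : T ≤ b := ciSup_le hub
  have haT : a ≤ T := (hlb 0).trans (le_ciSup hbdd 0)
  refine ⟨⟨haT, hTb⟩, ?_⟩
  rcases lt_trichotomy (f T) 0 with h | h | h
  · exfalso
    have hne : a < T := haT.lt_of_ne (by rintro h'; rw [← h'] at h; linarith)
    obtain ⟨ε, hε, hball⟩ := Metric.eventually_nhds_iff.1
      (hf.continuousAt.eventually_lt continuousAt_const h)
    -- Exceeding `a` as well as `T - ε` excludes the default value of `u`.
    obtain ⟨q, hq⟩ := exists_lt_of_lt_ciSup (f := u)
      (show max (T - ε) a < ⨆ q, u q from max_lt (by linarith) hne)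
    rw [max_lt_iff] at hq
    have hqT : u q ≤ T := le_ciSup hbdd q
    by_cases hc : ((q : ℝ) ∈ Set.Icc a b ∧ 0 < f q)
    · have e : u q = q := by simp only [hu]; rw [if_pos hc]
      rw [e] at hq hqT
      have := hball (y := (q : ℝ)) (by rw [Real.dist_eq, abs_lt]; constructor <;> linarith)
      linarith [hc.2]
    · have e : u q = a := by simp only [hu]; rw [if_neg hc]
      rw [e] at hq
      exact lt_irrefl _ hq.2
  · exact h
  · exfalso
    have hne : T < b := hTb.lt_of_ne (by rintro h'; rw [h'] at h; linarith)
    obtain ⟨ε, hε, hball⟩ := Metric.eventually_nhds_iff.1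
      (continuousAt_const.eventually_lt hf.continuousAt h)
    obtain ⟨q, hq1, hq2⟩ := exists_rat_btwn (show T < min (T + ε) b from lt_min (by linarith) hne)
    rw [lt_min_iff] at hq2
    have hc : (q : ℝ) ∈ Set.Icc a b ∧ 0 < f q :=
      ⟨⟨haT.trans hq1.le, hq2.2.le⟩,
        hball (by rw [Real.dist_eq, abs_lt]; constructor <;> linarith)⟩
    have e : u q = q := by simp only [hu]; rw [if_pos hc]
    have : u q ≤ T := le_ciSup hbdd q
    linarith

/-- Restricting to rational points makes the supremum countable. -/
theorem measurable_supRatPos {𝓨 : Type*} [MeasurableSpace 𝓨] (a b : ℝ) {g : 𝓨 → ℝ → ℝ}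
    (hg : ∀ t, Measurable fun x => g x t) : Measurable fun x => supRatPos a b (g x) := by
  unfold supRatPos
  refine Measurable.iSup fun q => Measurable.ite ?_ measurable_const measurable_const
  exact (MeasurableSet.const _).inter (measurableSet_lt measurable_const (hg q))

/-! ### Roots of estimating equations: existence, consistency, normality -/

section EstimatingEquation

variable {Ω 𝓧 : Type*} [MeasurableSpace Ω] [MeasurableSpace 𝓧] {P : Measure Ω}
  [IsProbabilityMeasure P] {ν : Measure 𝓧} {X : ℕ → Ω → 𝓧}

theorem tendstoInMeasure_sample_mean (hlaw : ∀ i, HasLaw (X i) ν P) (hindep : iIndepFun X P)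
    {f : 𝓧 → ℝ} (hf : Measurable f) (hint : Integrable f ν) :
    TendstoInMeasure P (fun (n : ℕ) ω => (∑ i : Fin n, f (X i ω)) / n) atTop
      (fun _ => ∫ x, f x ∂ν) := by
  have hm : ∀ i, AEMeasurable (fun ω => f (X i ω)) P :=
    fun i => hf.comp_aemeasurable (hlaw i).aemeasurable
  have hmean : ∫ x, f x ∂ν = P[fun ω => f (X 0 ω)] :=
    ((hlaw 0).integral_comp hf.aestronglyMeasurable).symm
  rw [hmean]
  refine tendstoInMeasure_of_tendsto_ae (fun n => ?_) ?_
  · exact ((Finset.aemeasurable_fun_sum Finset.univ fun (i : Fin n) _ => hm i).div_const _).aestronglyMeasurable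
  · have h := strong_law_ae_real (μ := P) (fun i ω => f (X i ω)) ?_ ?_ ?_
    · filter_upwards [h] with ω hω
      refine hω.congr fun n => ?_
      rw [Finset.sum_range]
    · rw [← (hlaw 0).map_eq] at hint
      exact (integrable_map_measure hf.aestronglyMeasurable (hlaw 0).aemeasurable).1 hint
    · exact fun i j hij => (hindep.indepFun hij).comp hf hf
    · exact fun i => ((hlaw i).identDistrib (hlaw 0)).comp hf

theorem tendstoInDistribution_sample_sum (hlaw : ∀ i, HasLaw (X i) ν P) (hindep : iIndepFun X P)
    {f : 𝓧 → ℝ} (hf : Measurable f) (hsq : Integrable (fun x => f x ^ 2) ν)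
    (hzero : ∫ x, f x ∂ν = 0) {Ω' : Type*} [MeasurableSpace Ω'] {P' : Measure Ω'}
    [IsProbabilityMeasure P'] {Z : Ω' → ℝ}
    (hZ : HasLaw Z (gaussianReal 0 (∫ x, f x ^ 2 ∂ν).toNNReal) P') :
    TendstoInDistribution (fun (n : ℕ) ω => (√n)⁻¹ * ∑ i : Fin n, f (X i ω)) atTop Z
      (fun _ => P) P' := by
  have hm : ∀ i, AEMeasurable (fun ω => f (X i ω)) P :=
    fun i => hf.comp_aemeasurable (hlaw i).aemeasurable
  have hmean : P[fun ω => f (X 0 ω)] = 0 := by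
    rw [← hzero]
    exact (hlaw 0).integral_comp hf.aestronglyMeasurable
  have hvar : Var[fun ω => f (X 0 ω); P] = ∫ x, f x ^ 2 ∂ν := by
    rw [variance_of_integral_eq_zero (hm 0) hmean]
    exact (hlaw 0).integral_comp (f := fun x => f x ^ 2) (hf.pow_const 2).aestronglyMeasurable
  have hL2 : MemLp (fun ω => f (X 0 ω)) 2 P := by
    rw [memLp_two_iff_integrable_sq (hm 0).aestronglyMeasurable]
    rw [← (hlaw 0).map_eq] at hsq
    exact (integrable_map_measure (hf.pow_const 2).aestronglyMeasurable (hlaw 0).aemeasurable).1 hsq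
  have h := tendstoInDistribution_inv_sqrt_mul_sum_sub (X := fun i ω => f (X i ω)) (P := P)
    (P' := P') (Y := Z) (by rw [hvar]; exact hZ) hL2 (hindep.comp (fun _ => f) fun _ => hf)
    (fun i => ((hlaw i).identDistrib (hlaw 0)).comp hf)
  rw [hmean] at h
  simpa only [mul_zero, sub_zero, Finset.sum_range] using h

/-- A smooth estimating function `ψ` for the parameter value `θ` and the law `ν` of one
observation: `ψ x` has at `θ` the derivative `-b x` with a quadratic remainder bounded by `m x`,
and `ψ · θ` is centred with variance equal to the mean of `b`. -/
structure IsEstimatingFunction (ν : Measure 𝓧) (θ : ℝ) (ψ : 𝓧 → ℝ → ℝ) (b m : 𝓧 → ℝ) : Prop where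
  continuous : ∀ x, Continuous (ψ x)
  measurable : ∀ a, Measurable fun x => ψ x a
  measurable_b : Measurable b
  measurable_m : Measurable m
  taylor : ∀ x a, |ψ x a - ψ x θ + b x * (a - θ)| ≤ m x * (a - θ) ^ 2
  integrable : Integrable (fun x => ψ x θ) ν
  integrable_sq : Integrable (fun x => ψ x θ ^ 2) ν
  integrable_b : Integrable b ν
  integrable_m : Integrable m ν
  integral_eq_zero : ∫ x, ψ x θ ∂ν = 0
  integral_b : ∫ x, b x ∂ν = ∫ x, ψ x θ ^ 2 ∂ν
  integral_sq_pos : 0 < ∫ x, ψ x θ ^ 2 ∂ν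

namespace IsEstimatingFunction

variable {θ : ℝ} {ψ : 𝓧 → ℝ → ℝ} {b m : 𝓧 → ℝ}

theorem taylor_mean (h : IsEstimatingFunction ν θ ψ b m) {n : ℕ} (x : Fin n → 𝓧) (a : ℝ) :
    |(∑ i, ψ (x i) a) / n - (∑ i, ψ (x i) θ) / n + (∑ i, b (x i)) / n * (a - θ)| ≤
      (∑ i, m (x i)) / n * (a - θ) ^ 2 := by
  have e : (∑ i, ψ (x i) a) / n - (∑ i, ψ (x i) θ) / n + (∑ i, b (x i)) / n * (a - θ) =
      (∑ i, (ψ (x i) a - ψ (x i) θ + b (x i) * (a - θ))) / n := by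
    rw [Finset.sum_add_distrib, Finset.sum_sub_distrib, ← Finset.sum_mul]
    ring
  rw [e, abs_div, Nat.abs_cast, div_mul_eq_mul_div, Finset.sum_mul]
  gcongr
  exact (Finset.abs_sum_le_sum_abs _ _).trans (Finset.sum_le_sum fun i _ => h.taylor _ _)

theorem tendsto_mean (h : IsEstimatingFunction ν θ ψ b m) (hlaw : ∀ i, HasLaw (X i) ν P)
    (hindep : iIndepFun X P) {ε : ℝ} (hε : 0 < ε) :
    Tendsto (fun n : ℕ => P {ω | ε ≤ |(∑ i : Fin n, ψ (X i ω) θ) / n|}) atTop (𝓝 0) := by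
  have := tendstoInMeasure_iff_norm.1
    (tendstoInMeasure_sample_mean hlaw hindep (h.measurable θ) h.integrable) ε hε
  simpa only [h.integral_eq_zero, sub_zero, Real.norm_eq_abs] using this

theorem tendsto_mean_b (h : IsEstimatingFunction ν θ ψ b m) (hlaw : ∀ i, HasLaw (X i) ν P)
    (hindep : iIndepFun X P) {ε : ℝ} (hε : 0 < ε) :
    Tendsto (fun n : ℕ => P {ω | ε ≤ |(∑ i : Fin n, b (X i ω)) / n - ∫ x, ψ x θ ^ 2 ∂ν|})
      atTop (𝓝 0) := by
  have := tendstoInMeasure_iff_norm.1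
    (tendstoInMeasure_sample_mean hlaw hindep h.measurable_b h.integrable_b) ε hε
  simpa only [h.integral_b, Real.norm_eq_abs] using this

theorem tendsto_mean_m (h : IsEstimatingFunction ν θ ψ b m) (hlaw : ∀ i, HasLaw (X i) ν P)
    (hindep : iIndepFun X P) :
    Tendsto (fun n : ℕ => P {ω | 1 ≤ |(∑ i : Fin n, m (X i ω)) / n - ∫ x, m x ∂ν|})
      atTop (𝓝 0) := by
  have := tendstoInMeasure_iff_norm.1
    (tendstoInMeasure_sample_mean hlaw hindep h.measurable_m h.integrable_m) 1 one_pos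
  simpa only [Real.norm_eq_abs] using this

theorem integral_m_nonneg (h : IsEstimatingFunction ν θ ψ b m) : 0 ≤ ∫ x, m x ∂ν :=
  integral_nonneg fun x => by
    have := (abs_nonneg _).trans (h.taylor x (θ + 1))
    simpa using this

/-- Existence of a consistent measurable root of the estimating equation. -/
theorem exists_consistent_root (h : IsEstimatingFunction ν θ ψ b m)
    (hlaw : ∀ i, HasLaw (X i) ν P) (hindep : iIndepFun X P) {δ₀ : ℝ} (hδ₀ : 0 < δ₀) :
    ∃ T : (n : ℕ) → (Fin n → 𝓧) → ℝ, (∀ n, Measurable (T n)) ∧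
      Tendsto (fun n : ℕ => P {ω | |T n (fun i => X i ω) - θ| < δ₀ ∧
        ∑ i : Fin n, ψ (X i ω) (T n (fun i => X i ω)) = 0}ᶜ) atTop (𝓝 0) ∧
      TendstoInMeasure P (fun n ω => T n (fun i => X i ω)) atTop (fun _ => θ) := by
  set J := ∫ x, ψ x θ ^ 2 ∂ν with hJdef
  have hJ : 0 < J := h.integral_sq_pos
  set K := ∫ x, m x ∂ν with hK
  have hK0 : 0 ≤ K := h.integral_m_nonneg
  -- Once `M < K + 1`, this choice keeps the quadratic remainder within `J / 4 * |a - θ|` for `|a -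
  -- θ| ≤ δ`.
  obtain ⟨δ, hδ, hδ1, hδ2⟩ : ∃ δ, 0 < δ ∧ δ < δ₀ ∧ (K + 1) * δ ≤ J / 4 := by
    refine ⟨min (δ₀ / 2) (J / 4 / (K + 1)), by positivity,
      (min_le_left _ _).trans_lt (by linarith), ?_⟩
    calc (K + 1) * _ ≤ (K + 1) * (J / 4 / (K + 1)) := by gcongr; exact min_le_right _ _
      _ = J / 4 := by field_simp
  let T : (n : ℕ) → (Fin n → 𝓧) → ℝ :=
    fun n x => supRatPos (θ - δ) (θ + δ) fun a => ∑ i, ψ (x i) a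
  -- Deterministic core. At `θ ± δ` the linear term exceeds `3 / 4 * J * δ` and the remainder is at
  -- most `J / 4 * δ`, leaving `J * δ / 2` to dominate `|G| < η`. At the root the same bounds give
  -- `J / 2 * |T - θ| ≤ |G| < η`.
  have key : ∀ (n : ℕ) (x : Fin n → 𝓧) (η : ℝ), 0 < η → η ≤ J * δ / 2 →
      |(∑ i, ψ (x i) θ) / n| < η → |(∑ i, b (x i)) / n - J| < J / 4 →
      |(∑ i, m (x i)) / n - K| < 1 →
      (|T n x - θ| < δ₀ ∧ ∑ i, ψ (x i) (T n x) = 0) ∧ |T n x - θ| < 2 * η / J := by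
    intro n x η hη hη2 h1 h2 h3
    have htay := h.taylor_mean x
    set B := (∑ i, b (x i)) / (n : ℝ)
    set M := (∑ i, m (x i)) / (n : ℝ)
    set G := (∑ i, ψ (x i) θ) / (n : ℝ)
    rw [abs_lt] at h1 h2 h3
    have hn : (0 : ℝ) ≤ n := n.cast_nonneg
    have hMδ : M * δ ^ 2 ≤ J / 4 * δ := by nlinarith
    have hBδ : 3 / 4 * J * δ < B * δ := by nlinarith
    have hneg : ∑ i, ψ (x i) (θ + δ) < 0 := by
      have ht := abs_le.1 (htay (θ + δ))
      rw [add_sub_cancel_left] at ht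
      have : (∑ i, ψ (x i) (θ + δ)) / (n : ℝ) < 0 := by linarith [ht.2]
      by_contra! hc
      exact absurd (div_nonneg hc hn) (not_le.2 this)
    have hpos : 0 < ∑ i, ψ (x i) (θ - δ) := by
      have ht := abs_le.1 (htay (θ - δ))
      rw [sub_sub_cancel_left, neg_sq] at ht
      have : 0 < (∑ i, ψ (x i) (θ - δ)) / (n : ℝ) := by linarith [ht.1]
      by_contra! hc
      exact absurd (div_nonpos_of_nonpos_of_nonneg hc hn) (not_le.2 this)
    obtain ⟨⟨hT1, hT2⟩, hT0⟩ := supRatPos_spec (by linarith)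
      (continuous_finsetSum _ fun i _ => h.continuous (x i)) hpos hneg
    change θ - δ ≤ T n x at hT1
    change T n x ≤ θ + δ at hT2
    change ∑ i, ψ (x i) (T n x) = 0 at hT0
    have hTδ : |T n x - θ| ≤ δ := abs_le.2 ⟨by linarith, by linarith⟩
    refine ⟨⟨hTδ.trans_lt hδ1, hT0⟩, ?_⟩
    have ht := htay (T n x)
    rw [hT0, zero_div, zero_sub] at ht
    set d := T n x - θ
    have hd0 := abs_nonneg d
    have hMd : M * d ^ 2 ≤ J / 4 * |d| := by
      rw [← sq_abs]
      calc M * |d| ^ 2 ≤ (K + 1) * |d| ^ 2 := by gcongr; linarith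
        _ = (K + 1) * |d| * |d| := by ring
        _ ≤ (K + 1) * δ * |d| := by gcongr
        _ ≤ J / 4 * |d| := by gcongr
    have hBd : 3 / 4 * J * |d| ≤ |B * d| := by
      rw [abs_mul]
      have : 3 / 4 * J ≤ |B| := le_trans (by linarith) (le_abs_self B)
      gcongr
    have hGB : |B * d| ≤ |G| + |-G + B * d| := by
      have := abs_add_le G (-G + B * d)
      rwa [add_neg_cancel_left] at this
    have hG : |G| < η := abs_lt.2 h1
    rw [lt_div_iff₀ hJ]
    linarith
  have hbad : ∀ η, 0 < η → Tendsto (fun n : ℕ => P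
      ({ω | η ≤ |(∑ i : Fin n, ψ (X i ω) θ) / n|} ∪
        ({ω | J / 4 ≤ |(∑ i : Fin n, b (X i ω)) / n - J|} ∪
        {ω | 1 ≤ |(∑ i : Fin n, m (X i ω)) / n - K|}))) atTop (𝓝 0) := fun η hη =>
    tendsto_measure_zero_union (h.tendsto_mean hlaw hindep hη)
      (tendsto_measure_zero_union (h.tendsto_mean_b hlaw hindep (by positivity))
        (h.tendsto_mean_m hlaw hindep))
  refine ⟨T, fun n => measurable_supRatPos _ _ fun a => Finset.measurable_fun_sum _ fun i _ =>
    (h.measurable a).comp (measurable_pi_apply i), ?_, ?_⟩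
  · refine tendsto_measure_zero_of_subset (fun n ω hω => ?_) (hbad (J * δ / 2) (by positivity))
    by_contra hc
    simp only [Set.mem_union, Set.mem_ofPred_eq, not_or, not_le] at hc
    exact hω (key n (fun i => X i ω) _ (by positivity) le_rfl hc.1 hc.2.1 hc.2.2).1
  · rw [tendstoInMeasure_iff_norm]
    intro ε hε
    refine tendsto_measure_zero_of_subset (fun n ω hω => ?_)
      (hbad (min (J * δ / 2) (J * ε / 2)) (by positivity))
    by_contra hc
    simp only [Set.mem_union, Set.mem_ofPred_eq, not_or, not_le] at hc
    have hlt := (key n (fun i => X i ω) _ (by positivity) (min_le_left _ _)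
      hc.1 hc.2.1 hc.2.2).2
    refine absurd hω (not_le.2 (hlt.trans_le ?_))
    rw [div_le_iff₀ hJ]
    linarith [min_le_right (J * δ / 2) (J * ε / 2)]

/-- Asymptotic normality of the consistent roots of an estimating equation. -/
theorem tendstoInDistribution_root (h : IsEstimatingFunction ν θ ψ b m)
    (hlaw : ∀ i, HasLaw (X i) ν P) (hindep : iIndepFun X P) {T : ℕ → Ω → ℝ}
    (hT : ∀ n, AEMeasurable (T n) P)
    (hroot : Tendsto (fun n : ℕ => P {ω | ∑ i : Fin n, ψ (X i ω) (T n ω) = 0}ᶜ) atTop (𝓝 0))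
    (hcons : TendstoInMeasure P T atTop (fun _ => θ)) :
    TendstoInDistribution (fun (n : ℕ) ω => √n * (T n ω - θ)) atTop (id : ℝ → ℝ) (fun _ => P)
      (gaussianReal 0 (1 / ∫ x, ψ x θ ^ 2 ∂ν).toNNReal) := by
  have hclt := fun Z hZ => tendstoInDistribution_sample_sum (P' := gaussianReal 0
    (1 / ∫ x, ψ x θ ^ 2 ∂ν).toNNReal) (Z := Z) hlaw hindep (h.measurable θ) h.integrable_sq
    h.integral_eq_zero hZ
  have hbB := fun ε hε => h.tendsto_mean_b hlaw hindep (ε := ε) hε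
  have hJ : 0 < ∫ x, ψ x θ ^ 2 ∂ν := h.integral_sq_pos
  generalize (∫ x, ψ x θ ^ 2 ∂ν) = J at hclt hbB hJ ⊢
  have hM := h.tendsto_mean_m hlaw hindep
  have hK0 : 0 ≤ ∫ x, m x ∂ν := h.integral_m_nonneg
  generalize (∫ x, m x ∂ν) = K at hM hK0
  -- The limit of the normalized sum is realized as `J * z` on the target space, so that dividing by
  -- `J` returns exactly `id`.
  have hZ : HasLaw (fun z : ℝ => J * z) (gaussianReal 0 J.toNNReal)
      (gaussianReal 0 (1 / J).toNNReal) := by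
    refine ⟨by fun_prop, ?_⟩
    rw [gaussianReal_map_const_mul, mul_zero]
    congr 1
    ext
    simp only [NNReal.coe_mul, NNReal.coe_mk]
    rw [Real.coe_toNNReal _ (by positivity), Real.coe_toNNReal _ hJ.le]
    field_simp
  have hU := hclt _ hZ
  have hGm : ∀ n : ℕ, AEMeasurable (fun ω => (∑ i : Fin n, ψ (X i ω) θ) / n) P := fun n =>
    (Finset.aemeasurable_fun_sum Finset.univ fun (i : Fin n) _ =>
      (h.measurable θ).comp_aemeasurable (hlaw i).aemeasurable).div_const _
  classical
  -- At a root, Taylor's bound gives `|Q - B| ≤ M * |T - θ|` when `T ≠ θ`; the default `J` is the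
  -- limit, so the case `T = θ` does no harm.
  let Q : ℕ → Ω → ℝ := fun n ω =>
    if T n ω = θ then J else ((∑ i : Fin n, ψ (X i ω) θ) / n) / (T n ω - θ)
  have hQm : ∀ n, AEMeasurable (Q n) P := by
    intro n
    have hmeas : Measurable fun p : ℝ × ℝ => if p.1 = θ then J else p.2 / (p.1 - θ) :=
      Measurable.ite (measurableSet_eq_fun measurable_fst measurable_const) measurable_const
        (by fun_prop)
    exact hmeas.comp_aemeasurable ((hT n).prodMk (hGm n))
  have hcons' := tendstoInMeasure_iff_norm.1 hcons
  have hQ : TendstoInMeasure P Q atTop (fun _ => J) := by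
    rw [tendstoInMeasure_iff_norm]
    intro ε hε
    have hη : 0 < ε / 2 / (K + 1) := by positivity
    refine tendsto_measure_zero_of_subset (fun n ω hω => ?_)
      (tendsto_measure_zero_union hroot (tendsto_measure_zero_union (hbB (ε / 2) (by positivity))
        (tendsto_measure_zero_union hM (hcons' _ hη))))
    by_contra hc
    simp only [Set.mem_union, Set.mem_compl_iff, Set.mem_ofPred_eq, not_or, not_le, not_not,
      Real.norm_eq_abs] at hc
    obtain ⟨h1, h2, h3, h4⟩ := hc
    simp only [Set.mem_ofPred_eq, Real.norm_eq_abs, Q] at hω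
    split_ifs at hω with hTθ
    · rw [sub_self, abs_zero] at hω
      linarith
    · have ht := h.taylor_mean (fun i : Fin n => X i ω) (T n ω)
      rw [h1, zero_div, zero_sub] at ht
      set B := (∑ i : Fin n, b (X i ω)) / (n : ℝ)
      set M := (∑ i : Fin n, m (X i ω)) / (n : ℝ)
      set G := (∑ i : Fin n, ψ (X i ω) θ) / (n : ℝ)
      set d := T n ω - θ
      have hd : d ≠ 0 := sub_ne_zero.2 hTθ
      have hd0 : 0 < |d| := abs_pos.2 hd
      have hGd : |G / d - B| ≤ M * |d| := by
        have e : G / d - B = -(-G + B * d) / d := by field_simp; ring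
        rw [e, abs_div, abs_neg, div_le_iff₀ hd0, mul_assoc, ← sq, sq_abs]
        exact ht
      have hMd : M * |d| ≤ ε / 2 := by
        calc M * |d| ≤ (K + 1) * |d| := by gcongr; linarith [(abs_lt.1 h3).2]
          _ ≤ (K + 1) * (ε / 2 / (K + 1)) := by gcongr
          _ = ε / 2 := by field_simp
      have := abs_sub_le (G / d) B J
      linarith
  -- Truncating the denominator at `J / 2` makes division continuous everywhere, as Slutsky's lemma
  -- requires; the truncation is inactive with probability tending to one.
  have hg : Continuous fun p : ℝ × ℝ => p.1 / max (J / 2) p.2 :=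
    continuous_fst.div (continuous_const.max continuous_snd)
      fun p => (lt_max_of_lt_left (by positivity)).ne'
  have hW := hU.continuous_comp_prodMk_of_tendstoInMeasure_const hg hQ hQm
  have hlim : (fun z : ℝ => J * z / max (J / 2) J) = id := by
    ext z
    rw [max_eq_right (by linarith), mul_div_cancel_left₀ _ hJ.ne', id]
  simp only [hlim] at hW
  refine tendstoInDistribution_of_tendstoInMeasure_sub _ _ hW ?_
    fun n => ((hT n).sub_const θ).const_mul _
  rw [tendstoInMeasure_iff_norm]
  intro ε hε
  refine tendsto_measure_zero_of_subset (fun n ω hω => ?_)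
    (tendsto_measure_zero_union hroot (tendstoInMeasure_iff_norm.1 hQ (J / 2) (by positivity)))
  by_contra hc
  simp only [Set.mem_union, Set.mem_compl_iff, Set.mem_ofPred_eq, not_or, not_le, not_not,
    Real.norm_eq_abs] at hc
  obtain ⟨h1, h2⟩ := hc
  rw [Set.mem_ofPred_eq] at hω
  refine absurd hω (not_le.2 ?_)
  suffices e : √n * (T n ω - θ) =
      ((√n)⁻¹ * ∑ i : Fin n, ψ (X i ω) θ) / max (J / 2) (Q n ω) by
    simp only [Pi.sub_apply, Pi.zero_apply, sub_zero]
    rw [e, sub_self, norm_zero]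
    exact hε
  have hQpos : J / 2 < Q n ω := by linarith [(abs_lt.1 h2).1]
  rw [max_eq_right hQpos.le]
  -- If `T = θ` is a root, the sum at `θ` vanishes and both sides are zero. Otherwise `Q ≠ 0` forces
  -- `n ≠ 0`, and the identity is algebra.
  by_cases hTθ : T n ω = θ
  · rw [hTθ] at h1 ⊢
    rw [h1]
    simp
  · have hQe : Q n ω = ((∑ i : Fin n, ψ (X i ω) θ) / n) / (T n ω - θ) := if_neg hTθ
    have hne : Q n ω ≠ 0 := (lt_trans (by positivity) hQpos).ne'
    rw [hQe] at hne ⊢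
    have hd : T n ω - θ ≠ 0 := sub_ne_zero.2 hTθ
    obtain ⟨hS, hn⟩ := div_ne_zero_iff.1 (div_ne_zero_iff.1 hne).1
    have hn0 : (0 : ℝ) ≤ n := n.cast_nonneg
    have hsq : √(n : ℝ) ≠ 0 := (Real.sqrt_pos.2 (hn0.lt_of_ne' hn)).ne'
    field_simp
    rw [Real.sq_sqrt hn0]

end IsEstimatingFunction

end EstimatingEquation

/-! ### Application to the bimodal normal likelihood -/

namespace BimodalNormal

theorem isEstimatingFunction_score {μ σ α : ℝ} (hσ : 0 < σ) (hα : α ≠ 0) :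
    IsEstimatingFunction (law μ σ α) α (fun x a => score μ σ a x) (obsInfo μ σ α)
      (fun x => 2 * |(x - μ) / σ| ^ 3) where
  continuous := continuous_score hσ
  measurable a := 
    (measurable_score hσ).comp (g := fun p : ℝ × ℝ => score μ σ p.2 p.1) (f := fun x => (x, a))
      (measurable_id.prodMk measurable_const)
  measurable_b := measurable_obsInfo α
  measurable_m := by fun_prop
  taylor x a := abs_score_sub_score_add_le hσ α a x
  integrable := integrable_score hσ α
  integrable_sq := integrable_score_sq hσ α
  integrable_b := integrable_obsInfo hσ α
  integrable_m := integrable_remainder hσ α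
  integral_eq_zero := integral_score hσ α
  integral_b := integral_obsInfo hσ α
  integral_sq_pos := fisherInfo_pos hσ hα

end BimodalNormal

theorem mainTheorem5 {Ω : Type*} [MeasurableSpace Ω] (P : Measure Ω) [IsProbabilityMeasure P]
    (μ σ α : ℝ) (hσ : 0 < σ) (hα : α ∈ BimodalNormal.paramSpace)
    (X : ℕ → Ω → ℝ) (hlaw : ∀ i, HasLaw (X i) (BimodalNormal.law μ σ α) P)
    (hindep : iIndepFun X P) :
    -- the Fisher information: it is finite, given by the stated formula, and positive
    (Integrable (fun x => (BimodalNormal.score μ σ α x) ^ 2) (BimodalNormal.law μ σ α) ∧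
      Integrable (fun z => z ^ 2 * (1 / Real.cosh (α * z))) (gaussianReal 0 1) ∧
      BimodalNormal.fisherInfo μ σ α =
        1 - Real.exp (-(α ^ 2) / 2) *
          ∫ z, z ^ 2 * (1 / Real.cosh (α * z)) ∂(gaussianReal 0 1) ∧
      0 < BimodalNormal.fisherInfo μ σ α) ∧
    -- a consistent solution exists, as a measurable function of the sample
    (∃ T : (n : ℕ) → (Fin n → ℝ) → ℝ, (∀ n, Measurable (T n)) ∧
      BimodalNormal.IsConsistentSolution P μ σ α X
        (fun n ω => T n (BimodalNormal.sample X n ω))) ∧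
    -- every consistent solution is asymptotically normal
    (∀ αhat : ℕ → Ω → ℝ, BimodalNormal.IsConsistentSolution P μ σ α X αhat →
      TendstoInDistribution (fun (n : ℕ) ω => Real.sqrt n * (αhat n ω - α)) atTop
        (id : ℝ → ℝ) (fun _ => P)
        (gaussianReal 0 (1 / BimodalNormal.fisherInfo μ σ α).toNNReal)) := by
  have hα0 : α ≠ 0 := abs_pos.1 hα
  have hE := BimodalNormal.isEstimatingFunction_score (μ := μ) hσ hα0
  refine ⟨⟨BimodalNormal.integrable_score_sq hσ α, BimodalNormal.integrable_sq_mul_sech α,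
    BimodalNormal.fisherInfo_eq hσ α, BimodalNormal.fisherInfo_pos hσ hα0⟩, ?_, ?_⟩
  -- The radius `|α|` keeps the root away from `0`, hence inside the parameter space.
  · obtain ⟨T, hTm, hroot, hcons⟩ := hE.exists_consistent_root hlaw hindep (abs_pos.2 hα0)
    refine ⟨T, hTm, fun n => ?_, ?_, hcons⟩
    · exact (hTm n).comp_aemeasurable (aemeasurable_pi_lambda _ fun i => (hlaw i).aemeasurable)
    · refine tendsto_measure_one_of_compl (tendsto_measure_zero_of_subset (fun n => ?_) hroot)
      refine Set.compl_subset_compl.2 fun ω hω => ⟨?_, ?_⟩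
      · refine abs_pos.2 fun (h0 : T n (BimodalNormal.sample X n ω) = 0) => ?_
        have h1 := hω.1
        change |T n (BimodalNormal.sample X n ω) - α| < |α| at h1
        rw [h0, zero_sub, abs_neg] at h1
        exact lt_irrefl _ h1
      · rw [BimodalNormal.deriv_logLikelihood hσ]
        exact hω.2
  · intro αhat hhat
    have hX := fun i => (hlaw i).aemeasurable
    -- Null measurability turns probability tending to one into complements of vanishing
    -- probability.
    have hmeas : ∀ n, NullMeasurableSet {ω | αhat n ω ∈ BimodalNormal.paramSpace ∧
        deriv (BimodalNormal.logLikelihood μ σ (BimodalNormal.sample X n ω)) (αhat n ω) = 0} P := by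
      intro n
      simp only [BimodalNormal.deriv_logLikelihood hσ]
      refine NullMeasurableSet.inter ?_ ?_
      · exact (hhat.aemeasurable n).nullMeasurableSet_preimage
          (measurableSet_lt measurable_const measurable_id.abs)
      · have hsum : AEMeasurable (fun ω => ∑ i : Fin n,
            BimodalNormal.score μ σ (αhat n ω) (X i ω)) P :=
          Finset.aemeasurable_fun_sum Finset.univ fun (i : Fin n) _ =>
            (BimodalNormal.measurable_score hσ).comp_aemeasurable
              (f := fun ω => (X i ω, αhat n ω))
              ((hX i).prodMk (hhat.aemeasurable n))
        exact hsum.nullMeasurableSet_preimage (measurableSet_singleton 0)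
    refine hE.tendstoInDistribution_root hlaw hindep hhat.aemeasurable ?_ hhat.consistent
    refine tendsto_measure_zero_of_subset (fun n => ?_)
      (tendsto_measure_compl_zero hmeas hhat.solves)
    refine Set.compl_subset_compl.2 fun ω hω => ?_
    have := hω.2
    rwa [BimodalNormal.deriv_logLikelihood hσ] at this
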